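/- All graphs are finite, simple and undirected. For a graph $G=(V,E)$ with $n=|V|$, let $\alpha(G)$ be the maximum cardinality of a stable (independent) set and let $\overline\chi(G)$ be the minimum number of cliques of $G$ whose union is $V$ (the chromatic number of the complement of $G$). An edge $e$ is critical if $\alpha(G\setminus e)=\alpha(G)+1$; $G$ is critical if all its edges are critical, and acritical if none is. Let $A_G$, $I$, $J$ be the adjacency, identity and all-ones matrices of size $n$. For $r\in\mathbb N=\{0,1,2,\dots\}$ let $$\mathcal K^{(r)}_n=\Big\{M\in\mathbb R^{n\times n}\text{ symmetric}:\ \Big(\sum_{i=1}^n x_i^2\Big)^r\sum_{i,j=1}^n M_{ij}x_i^2x_j^2 \text{ is a sum of squares of real polynomials}\Big\},$$ $$\vartheta^{(r)}(G)=\min\{t\in\mathbb R:\ t(A_G+I)-J\in\mathcal K^{(r)}_n\},$$ and let $\vartheta\text{-rank}(G)$ be the smallest $r\in\mathbb N$ with $\vartheta^{(r)}(G)=\alpha(G)$ (and $\infty$ if there is none). (For the graph with no vertices the minimum is read as $0$.) **Proposition.** Let $G=(V,E)$ be a graph. (i) If $\alpha(G)\ge |V|-2$, then $\overline\chi(G)=\alpha(G)$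 and $\vartheta\text{-rank}(G)=0$. (ii) If $\alpha(G)=|V|-3$, then $\overline\chi(G)=\alpha(G)$ and $\vartheta\text{-rank}(G)=0$, unless $G$ is the disjoint union of a $5$-cycle $C_5$ and $m\ge 0$ isolated nodes, in which case $\vartheta\text{-rank}(G)\ge 1$ and $G$ is critical. (iii) If $\alpha(G)=|V|-4$ and $G$ is acritical, then $\overline\chi(G)=\alpha(G)$ and $\vartheta\text{-rank}(G)=0$. -/

import Mathlib

namespace ThetaRank

/-- The polynomial `(x^{∘2})ᵀ M x^{∘2} = ∑ i j, M i j * x i ^ 2 * x j ^ 2`. -/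
noncomputable def squareForm {V : Type*} [Fintype V] (M : Matrix V V ℝ) : MvPolynomial V ℝ :=
  ∑ i, ∑ j, MvPolynomial.C (M i j) * (MvPolynomial.X i ^ 2 * MvPolynomial.X j ^ 2)

/-- Parrilo's cone `𝒦^(r)` of symmetric matrices indexed by `V`: those `M` for which
`(∑ i, x i ^ 2) ^ r * (x^{∘2})ᵀ M x^{∘2}` is a sum of squares of real polynomials. -/
def parriloCone (V : Type*) [Fintype V] (r : ℕ) : Set (Matrix V V ℝ) :=
  {M | M.IsSymm ∧
    IsSumSq ((∑ i, (MvPolynomial.X i : MvPolynomial V ℝ) ^ 2) ^ r * squareForm M)}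

/-- The bound `ϑ^(r)(G) = min {t : t (A_G + I) - J ∈ 𝒦^(r)}`. If `V` is nonempty then this set of
reals is nonempty (it contains `|V|`), bounded below by `α(G)`, and closed, so that its infimum
is attained. -/
noncomputable def thetaBound {V : Type*} [Fintype V] [DecidableEq V] (G : SimpleGraph V)
    [DecidableRel G.Adj] (r : ℕ) : ℝ :=
  sInf {t : ℝ | t • (G.adjMatrix ℝ + 1) - Matrix.of (fun _ _ => (1 : ℝ)) ∈ parriloCone V r}

/-- The `ϑ`-rank of `G`: the smallest `r` with `ϑ^(r)(G) = α(G)`, and `⊤` if there is none. -/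
noncomputable def thetaRank {V : Type*} [Fintype V] [DecidableEq V] (G : SimpleGraph V)
    [DecidableRel G.Adj] : ℕ∞ :=
  ⨅ r : {r : ℕ // thetaBound G r = (G.indepNum : ℝ)}, ((r : ℕ) : ℕ∞)

/-- `χ̄(G)`: the minimum number of cliques of `G` that cover all vertices, that is, the
chromatic number of the complement. -/
noncomputable def cliqueCoverNumber {V : Type*} (G : SimpleGraph V) : ℕ∞ :=
  Gᶜ.chromaticNumber

/-- The edge `e` is critical: deleting it increases the stability number by one. -/
def IsCriticalEdge {V : Type*} (G : SimpleGraph V) (e : Sym2 V) : Prop :=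
  e ∈ G.edgeSet ∧ (G.deleteEdges {e}).indepNum = G.indepNum + 1

/-- All edges are critical. -/
def IsCritical {V : Type*} (G : SimpleGraph V) : Prop :=
  ∀ e ∈ G.edgeSet, IsCriticalEdge G e

/-- No edge is critical. -/
def IsAcritical {V : Type*} (G : SimpleGraph V) : Prop :=
  ∀ e ∈ G.edgeSet, ¬ IsCriticalEdge G e

/-- `G` is the disjoint union of a 5-cycle and `m ≥ 0` isolated nodes. -/
def IsC5PlusIsolated {V : Type*} (G : SimpleGraph V) : Prop :=
  ∃ m : ℕ, Nonempty (G ≃g (SimpleGraph.cycleGraph 5 ⊕g (⊥ : SimpleGraph (Fin m))))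

end ThetaRank

/-!
Let `S` be a maximum stable set and `α = |S|`. The bounds `α ≤ ϑ⁽⁰⁾ ≤ χ̄` hold for every graph: the
first comes from pairing with the matrix `1_S 1_Sᵀ`, the second from an explicit sum of squares
attached to a partition into cliques (`mem_parriloCone_of_compl_coloring`). So a cover by
`α` cliques settles both `χ̄ = α` and `ϑ-rank = 0`. Each clique of such a cover contains exactly one
vertex of `S`, so what has to be found is an assignment of the vertices outside `S` to neighbours in
`S` in which vertices with the same image are adjacent (`IsCliqueAssignable`): a list colouring of
the complement of `G[V \ S]`, where the list of a vertex is its set of neighbours in `S`.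

Maximality of `S` is Hall's condition on stable subsets of `V \ S`
(`isCliqueAssignable_of_isIndepSet`), and a vertex with a longer list than it has nonneighbours can
be coloured last (`IsCliqueAssignable.of_erase`). These two facts handle `|V \ S| ≤ 2`, and for
`|V \ S| = 3` they leave only a configuration that is a 5-cycle plus isolated nodes. In an acritical
graph every list has at least two elements, and for four such vertices what Hall's theorem and
greedy extension leave is the list colouring of a 4-cycle or of a diamond
(`exists_diamond_list_coloring`).

For a 5-cycle with `m` isolated nodes, comparing coefficients shows that `𝒦⁽⁰⁾` pairs nonnegatively
with doubly nonnegative matrices (`sum_mul_nonneg_of_mem_parriloCone_zero`). A rational such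
matrix, `fiveCycleWeight`, vanishing on the edges gives
`ϑ⁽⁰⁾ ≥ (605 + 550 m + 125 m²) / (275 + 125 m) > m + 2 = α`.
-/

/-! ### Sums of squares and the cone `𝒦⁽⁰⁾` -/

open MvPolynomial in
/-- Along a coordinate axis, if the coefficients of `a` below degree `k` vanish, the coefficient of
`a * a` in degree `2 * k` is a square: the only surviving term is the middle one. -/
theorem coeff_mul_self_single {V : Type*} (a : MvPolynomial V ℝ) (i : V) (k : ℕ)
    (h : ∀ l < k, coeff (Finsupp.single i l) a = 0) :
    coeff (Finsupp.single i (2 * k)) (a * a) = coeff (Finsupp.single i k) a ^ 2 := by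
  classical
  rw [coeff_mul, Finsupp.antidiagonal_single, Finset.sum_map, Finset.sum_eq_single (k, k)]
  · simp [sq]
  · rintro ⟨p, q⟩ hpq hne
    rw [Finset.HasAntidiagonal.mem_antidiagonal] at hpq
    simp only [ne_eq, Prod.mk.injEq] at hne hpq
    rcases lt_or_ge p k with hp | hp
    · simp [h p hp]
    · have hq : q < k := by omega
      simp [h q hq]
  · intro hk
    exact absurd (Finset.HasAntidiagonal.mem_antidiagonal.2 (two_mul k).symm) hk

open MvPolynomial in
/-- If `a` has no constant and no linear term, then its coefficients `u i` at `x i ^ 2` satisfy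
`2 * u i * u j ≤ [x i ^ 2 * x j ^ 2] a ^ 2`; the defect is the square of the coefficient
at `x i * x j`. -/
theorem two_mul_coeff_mul_coeff_le {V : Type*} (a : MvPolynomial V ℝ) {i j : V} (hij : i ≠ j)
    (h0 : coeff 0 a = 0) (h1 : ∀ i, coeff (Finsupp.single i 1) a = 0) :
    2 * (coeff (Finsupp.single i 2) a * coeff (Finsupp.single j 2) a) ≤
      coeff (Finsupp.single i 2 + Finsupp.single j 2) (a * a) := by
  classical
  have ne1 : (Finsupp.single i 2 : V →₀ ℕ) ≠ Finsupp.single j 2 := by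
    intro h; simpa [hij, hij.symm] using DFunLike.congr_fun h i
  have ne2 : (Finsupp.single i 2 : V →₀ ℕ) ≠ Finsupp.single i 1 + Finsupp.single j 1 := by
    intro h; simpa [hij, hij.symm] using DFunLike.congr_fun h i
  have ne3 : (Finsupp.single j 2 : V →₀ ℕ) ≠ Finsupp.single i 1 + Finsupp.single j 1 := by
    intro h; simpa [hij, hij.symm] using DFunLike.congr_fun h i
  rw [coeff_mul, ← Finset.sum_subset (s₁ := {(Finsupp.single i 2, Finsupp.single j 2),
    (Finsupp.single j 2, Finsupp.single i 2), (Finsupp.single i 1 + Finsupp.single j 1,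
      Finsupp.single i 1 + Finsupp.single j 1)})]
  · rw [Finset.sum_insert (by simp [ne1, ne2]), Finset.sum_insert (by simp [ne3]),
      Finset.sum_singleton]
    nlinarith [mul_self_nonneg (coeff (Finsupp.single i 1 + Finsupp.single j 1) a)]
  · intro x hx
    simp only [Finset.mem_insert, Finset.mem_singleton] at hx
    rw [Finset.HasAntidiagonal.mem_antidiagonal]
    rcases hx with rfl | rfl | rfl
    · rfl
    · exact add_comm _ _
    · ext k
      simp only [Finsupp.add_apply, Finsupp.single_apply]
      split_ifs <;> rfl
  · rintro ⟨α, β⟩ hx hne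
    rw [Finset.HasAntidiagonal.mem_antidiagonal] at hx
    dsimp only at hx ⊢
    -- both exponents are supported on `{i, j}`
    have key : ∀ γ δ : V →₀ ℕ, γ + δ = Finsupp.single i 2 + Finsupp.single j 2 →
        γ = Finsupp.single i (γ i) + Finsupp.single j (γ j) := by
      intro γ δ h
      ext k
      have hk := DFunLike.congr_fun h k
      simp only [Finsupp.add_apply, Finsupp.single_apply] at hk ⊢
      split_ifs at hk ⊢ with h1 h2 h2 <;> subst_vars <;> first | omega | exact absurd rfl hij
    have hα := key α β hx
    have hβ := key β α (by rw [add_comm]; exact hx)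
    have hi := DFunLike.congr_fun hx i
    have hj := DFunLike.congr_fun hx j
    simp only [Finsupp.add_apply, Finsupp.single_apply, hij, hij.symm, if_true, if_false] at hi hj
    generalize α i = p at *
    generalize α j = q at *
    generalize β i = p' at *
    generalize β j = q' at *
    have hp : p ≤ 2 := by omega
    have hq : q ≤ 2 := by omega
    have hp' : p' = 2 - p := by omega
    have hq' : q' = 2 - q := by omega
    subst hp' hq' hα hβ
    clear hx hi hj
    interval_cases p <;> interval_cases q <;>
      first
      | (simp [h0, h1]; done)
      | exact absurd (by simp) hne

/-- The linear functional that reads off the entry `M i j` from `squareForm M` for symmetric `M`. -/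
noncomputable def squareCoeff {V : Type*} [DecidableEq V] (i j : V) (p : MvPolynomial V ℝ) : ℝ :=
  if i = j then p.coeff (Finsupp.single i 4)
  else p.coeff (Finsupp.single i 2 + Finsupp.single j 2) / 2

theorem squareCoeff_add {V : Type*} [DecidableEq V] (i j : V) (p q : MvPolynomial V ℝ) :
    squareCoeff i j (p + q) = squareCoeff i j p + squareCoeff i j q := by
  unfold squareCoeff
  split_ifs
  · simp
  · simp [add_div]

open MvPolynomial in
theorem coeff_squareForm {V : Type*} [Fintype V] [DecidableEq V] (M : Matrix V V ℝ)
    (d : V →₀ ℕ) : coeff d (ThetaRank.squareForm M) =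
      ∑ k, ∑ l, if Finsupp.single k 2 + Finsupp.single l 2 = d then M k l else 0 := by
  unfold ThetaRank.squareForm
  simp only [coeff_sum]
  refine Finset.sum_congr rfl fun k _ => Finset.sum_congr rfl fun l _ => ?_
  rw [coeff_C_mul, X_pow_eq_monomial, X_pow_eq_monomial, monomial_mul, coeff_monomial]
  simp

theorem squareCoeff_squareForm {V : Type*} [Fintype V] [DecidableEq V] {M : Matrix V V ℝ}
    (hM : M.IsSymm) (i j : V) : squareCoeff i j (ThetaRank.squareForm M) = M i j := by
  unfold squareCoeff
  split_ifs with hij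
  · subst hij
    have h4 : (Finsupp.single i 4 : V →₀ ℕ) = Finsupp.single i 2 + Finsupp.single i 2 := by
      rw [← Finsupp.single_add]
    rw [coeff_squareForm, h4, Finset.sum_eq_single i, Finset.sum_eq_single i]
    · simp
    · intro l _ hl
      refine if_neg ?_
      rw [Finsupp.single_add_single_eq_single_add_single two_ne_zero two_ne_zero]
      simp [hl]
    · simp
    · intro k _ hk
      refine Finset.sum_eq_zero fun l _ => if_neg ?_
      rw [Finsupp.single_add_single_eq_single_add_single two_ne_zero two_ne_zero]
      simp [hk]
    · simp
  · have : ∀ k l, (if (Finsupp.single k 2 + Finsupp.single l 2 : V →₀ ℕ) =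
        Finsupp.single i 2 + Finsupp.single j 2 then M k l else 0) =
        (if k = i then if l = j then M k l else 0 else 0) +
        (if k = j then if l = i then M k l else 0 else 0) := by
      intro k l
      simp only [Finsupp.single_add_single_eq_single_add_single (M := ℕ) two_ne_zero two_ne_zero]
      have : ¬ j = i := fun h => hij h.symm
      by_cases h1 : k = i <;> by_cases h2 : k = j <;> by_cases h3 : l = i <;>
        by_cases h4 : l = j <;> simp_all
    rw [coeff_squareForm]
    simp only [this, Finset.sum_add_distrib]
    simp [hM.apply i j]

open MvPolynomial in
/-- The homogeneous quartic part of a sum of squares pairs nonnegatively with a doubly nonnegative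
matrix `Y`. The induction on the number of squares also tracks the coefficients of degree `0`
and `2`, whose vanishing forces every summand to be the square of a polynomial without constant
and linear terms. -/
theorem isSumSq_low_coeff_and_pairing {V : Type*} [Fintype V] [DecidableEq V] {Y : V → V → ℝ}
    (hY : ∀ i j, i ≠ j → 0 ≤ Y i j) (hpsd : ∀ u : V → ℝ, 0 ≤ ∑ i, ∑ j, u i * u j * Y i j)
    {p : MvPolynomial V ℝ} (hp : IsSumSq p) :
    0 ≤ coeff 0 p ∧ (coeff 0 p = 0 → (∀ i, 0 ≤ coeff (Finsupp.single i 2) p) ∧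
      ((∀ i, coeff (Finsupp.single i 2) p = 0) →
        0 ≤ ∑ i, ∑ j, squareCoeff i j p * Y i j)) := by
  induction hp with
  | zero => simp [squareCoeff]
  | sq_add a hs ih =>
    rename_i s
    obtain ⟨ih0, ih⟩ := ih
    have e0 : coeff 0 (a * a + s) = coeff 0 a ^ 2 + coeff 0 s := by
      have := constantCoeff_eq (R := ℝ) (σ := V)
      rw [coeff_add, ← this, map_mul, sq]
    rw [e0]
    refine ⟨by positivity, fun h => ?_⟩
    have ha0 : coeff 0 a = 0 := by nlinarith [sq_nonneg (coeff 0 a)]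
    obtain ⟨ih1, ih2⟩ := ih (by nlinarith [sq_nonneg (coeff 0 a)])
    have e1 : ∀ i, coeff (Finsupp.single i 2) (a * a + s) =
        coeff (Finsupp.single i 1) a ^ 2 + coeff (Finsupp.single i 2) s := by
      intro i
      rw [coeff_add, coeff_mul_self_single a i 1 (by simp [ha0])]
    simp only [e1]
    refine ⟨fun i => add_nonneg (sq_nonneg _) (ih1 i), fun h2 => ?_⟩
    have ha1 : ∀ i, coeff (Finsupp.single i 1) a = 0 := fun i => by
      nlinarith [sq_nonneg (coeff (Finsupp.single i 1) a), ih1 i, h2 i]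
    have ih3 := ih2 fun i => by nlinarith [sq_nonneg (coeff (Finsupp.single i 1) a), ih1 i, h2 i]
    have hle : ∀ i j, coeff (Finsupp.single i 2) a * coeff (Finsupp.single j 2) a * Y i j ≤
        squareCoeff i j (a * a) * Y i j := by
      intro i j
      unfold squareCoeff
      split_ifs with hij
      · subst hij
        rw [coeff_mul_self_single a i 2, sq]
        intro l hl
        interval_cases l
        · simpa using ha0
        · exact ha1 i
      · have := two_mul_coeff_mul_coeff_le a hij ha0 ha1
        exact mul_le_mul_of_nonneg_right (by linarith) (hY i j hij)
    have := Finset.sum_le_sum fun i (_ : i ∈ Finset.univ) =>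
      Finset.sum_le_sum fun j (_ : j ∈ Finset.univ) => hle i j
    have h3 := hpsd fun i => coeff (Finsupp.single i 2) a
    simp only [squareCoeff_add, add_mul, Finset.sum_add_distrib]
    linarith

/-- Doubly nonnegative matrices lie in the dual of `𝒦⁽⁰⁾`. -/
theorem sum_mul_nonneg_of_mem_parriloCone_zero {V : Type*} [Fintype V] [DecidableEq V]
    {Y : V → V → ℝ} (hY : ∀ i j, i ≠ j → 0 ≤ Y i j)
    (hpsd : ∀ u : V → ℝ, 0 ≤ ∑ i, ∑ j, u i * u j * Y i j)
    {M : Matrix V V ℝ} (hM : M ∈ ThetaRank.parriloCone V 0) :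
    0 ≤ ∑ i, ∑ j, M i j * Y i j := by
  obtain ⟨hsymm, hsos⟩ := hM
  rw [pow_zero, one_mul] at hsos
  obtain ⟨-, h⟩ := isSumSq_low_coeff_and_pairing hY hpsd hsos
  have low : ∀ d : V →₀ ℕ, d.degree < 4 → (ThetaRank.squareForm M).coeff d = 0 := by
    intro d hd
    rw [coeff_squareForm]
    refine Finset.sum_eq_zero fun k _ => Finset.sum_eq_zero fun l _ => if_neg ?_
    rintro rfl
    simp at hd
  have := (h (low 0 (by simp))).2 fun i => low _ (by simp)
  simpa only [squareCoeff_squareForm hsymm] using this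

/-! ### The bound `ϑ⁽⁰⁾` between the stability number and the clique cover number -/

/-- Pairing with `1_S 1_Sᵀ` for a maximum stable set `S` turns feasibility of `t` into
`0 ≤ t * α - α ^ 2`; hence `ϑ⁽⁰⁾` is at least `α`. -/
theorem indepNum_le_of_mem_parriloCone {V : Type*} [Fintype V] [DecidableEq V] [Nonempty V]
    (G : SimpleGraph V) [DecidableRel G.Adj] {t : ℝ}
    (ht : t • (G.adjMatrix ℝ + 1) - Matrix.of (fun _ _ => (1 : ℝ)) ∈ ThetaRank.parriloCone V 0) :
    (G.indepNum : ℝ) ≤ t := by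
  obtain ⟨S, hS⟩ := G.exists_isNIndepSet_indepNum
  have hpos : 0 < G.indepNum := by
    obtain ⟨v⟩ := ‹Nonempty V›
    have : G.IsIndepSet (({v} : Finset V) : Set V) := by simp [SimpleGraph.isIndepSet_iff]
    simpa [Nat.succ_le_iff] using this.card_le_indepNum
  have h := sum_mul_nonneg_of_mem_parriloCone_zero
    (Y := fun i j => (if i ∈ S then 1 else 0) * if j ∈ S then 1 else 0)
    (fun i j _ => by positivity)
    (fun u => by
      have : ∀ i j, u i * u j * ((if i ∈ S then (1 : ℝ) else 0) * if j ∈ S then 1 else 0) =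
        (u i * if i ∈ S then 1 else 0) * (u j * if j ∈ S then 1 else 0) := fun i j => by ring
      simp only [this, ← Finset.mul_sum, ← Finset.sum_mul]
      exact mul_self_nonneg _) ht
  have e : ∀ i j, (t • (G.adjMatrix ℝ + 1) - Matrix.of (fun _ _ => (1 : ℝ)) : Matrix V V ℝ) i j *
      ((if i ∈ S then 1 else 0) * if j ∈ S then 1 else 0) =
      if i ∈ S then ((if i = j then t else 0) - if j ∈ S then 1 else 0) else 0 := by
    intro i j
    by_cases hi : i ∈ S <;> by_cases hj : j ∈ S <;> simp [hi, hj, Matrix.one_apply]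
    · by_cases hij : i = j
      · simp [hij]
      · simp [hS.isIndepSet hi hj hij]
    · rintro rfl
      exact absurd hi hj
  have e' : ∀ i, ∑ j, (if i ∈ S then ((if i = j then t else 0) - if j ∈ S then (1 : ℝ) else 0)
      else 0) = if i ∈ S then t - G.indepNum else 0 := by
    intro i
    split_ifs
    · simp [Finset.sum_sub_distrib, hS.card_eq]
    · simp
  simp only [e, e'] at h
  simp only [Finset.sum_ite_mem, Finset.univ_inter, Finset.sum_const, hS.card_eq,
    nsmul_eq_mul] at h
  have hpos' : (0 : ℝ) < G.indepNum := by exact_mod_cast hpos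
  nlinarith

open MvPolynomial in
theorem isSumSq_C_mul {V : Type*} {r : ℝ} (hr : 0 ≤ r) {p : MvPolynomial V ℝ} (hp : IsSquare p) :
    IsSumSq (C r * p) := by
  obtain ⟨q, rfl⟩ := hp
  have : C r * (q * q) = (C (√r) * q) * (C (√r) * q) := by
    rw [mul_mul_mul_comm, ← C_mul, Real.mul_self_sqrt hr]
  rw [this]
  exact IsSumSq.mul_self _

open MvPolynomial in
/-- A partition of the vertices into `k` cliques certifies `ϑ⁽⁰⁾ ≤ k`: with `y c` the sum of the
`x i ^ 2` over the `c`-th clique, the form of `k (A + I) - J` is `½ ∑ (y c - y d) ^ 2` plus `k`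
times the monomials `x i ^ 2 * x j ^ 2` of the edges between different cliques. -/
theorem mem_parriloCone_of_compl_coloring {V : Type*} [Fintype V] [DecidableEq V]
    (G : SimpleGraph V) [DecidableRel G.Adj] {k : ℕ} (K : Gᶜ.Coloring (Fin k)) :
    (k : ℝ) • (G.adjMatrix ℝ + 1) - Matrix.of (fun _ _ => (1 : ℝ)) ∈ ThetaRank.parriloCone V 0 := by
  have hsymm : ((k : ℝ) • (G.adjMatrix ℝ + 1) - Matrix.of (fun _ _ => (1 : ℝ))).IsSymm := by
    refine ((G.isSymm_adjMatrix.add Matrix.isSymm_one).smul _).sub ?_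
    exact Matrix.IsSymm.ext fun i j => rfl
  refine ⟨hsymm, ?_⟩
  rw [pow_zero, one_mul]
  set y : Fin k → MvPolynomial V ℝ := fun c => ∑ i, if K i = c then X i ^ 2 else 0 with hy
  have hsum : ∑ c, y c = ∑ i, X i ^ 2 := by
    simp only [hy]
    rw [Finset.sum_comm]
    simp
  have hsq : ∑ c, y c * y c = ∑ i, ∑ j, if K i = K j then X i ^ 2 * X j ^ 2 else 0 := by
    simp only [hy, Finset.sum_mul_sum]
    rw [Finset.sum_comm]
    refine Finset.sum_congr rfl fun i _ => ?_
    rw [Finset.sum_comm]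
    refine Finset.sum_congr rfl fun j _ => ?_
    simp [eq_comm]
  have hdiff : ∑ c, ∑ d, (y c - y d) * (y c - y d) =
      2 * ((k : MvPolynomial V ℝ) * ∑ c, y c * y c - (∑ c, y c) * ∑ c, y c) := by
    have : ∀ c d, (y c - y d) * (y c - y d) = y c * y c + y d * y d - 2 * (y c * y d) :=
      fun c d => by ring
    simp only [this, Finset.sum_sub_distrib, Finset.sum_add_distrib, ← Finset.mul_sum,
      Finset.sum_const, Finset.card_univ, Fintype.card_fin, nsmul_eq_mul]
    simp only [mul_left_comm _ (k : MvPolynomial V ℝ), ← Finset.mul_sum,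
      ← Finset.sum_mul]
    ring
  have hform : ThetaRank.squareForm
      ((k : ℝ) • (G.adjMatrix ℝ + 1) - Matrix.of (fun _ _ => (1 : ℝ))) =
      ∑ c, ∑ d, C (1 / 2) * ((y c - y d) * (y c - y d)) +
      ∑ i, ∑ j, C (k * ((G.adjMatrix ℝ + 1) i j - if K i = K j then 1 else 0)) *
        (X i ^ 2 * X j ^ 2) := by
    have h2 : (C (1 / 2) : MvPolynomial V ℝ) * 2 = 1 := by
      rw [show (2 : MvPolynomial V ℝ) = C 2 from rfl, ← C_mul]
      norm_num
    simp only [← Finset.mul_sum, hdiff]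
    rw [← mul_assoc, h2, one_mul, hsum, hsq, Finset.sum_mul_sum]
    unfold ThetaRank.squareForm
    simp only [Finset.mul_sum (a := (k : MvPolynomial V ℝ)), ← Finset.sum_sub_distrib,
      ← Finset.sum_add_distrib]
    refine Finset.sum_congr rfl fun i _ => Finset.sum_congr rfl fun j _ => ?_
    have hk : (k : MvPolynomial V ℝ) = C (k : ℝ) := by simp
    have he : ((k : ℝ) • (G.adjMatrix ℝ + 1) - Matrix.of (fun _ _ => (1 : ℝ)) : Matrix V V ℝ) i j =
        k * (G.adjMatrix ℝ + 1) i j - 1 := rfl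
    rw [hk, he]
    split_ifs <;> simp only [C_mul, C_sub, C_1, C_0] <;> ring
  rw [hform]
  refine IsSumSq.add (IsSumSq.sum fun c _ => IsSumSq.sum fun d _ => ?_)
    (IsSumSq.sum fun i _ => IsSumSq.sum fun j _ => ?_)
  · exact isSumSq_C_mul (by norm_num) ⟨_, rfl⟩
  · refine isSumSq_C_mul (mul_nonneg (Nat.cast_nonneg k) ?_) ⟨X i * X j, by ring⟩
    by_cases hij : i = j
    · simp [hij]
    · by_cases hadj : G.Adj i j
      · simp only [Matrix.add_apply, SimpleGraph.adjMatrix_apply, hadj, Matrix.one_apply, hij]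
        split_ifs <;> norm_num
      · have : K i ≠ K j := K.valid ((SimpleGraph.compl_adj G i j).2 ⟨hij, hadj⟩)
        simp [this, hij, hadj]

/-- A cover by `α` cliques closes the gap `α ≤ ϑ⁽⁰⁾ ≤ χ̄`. -/
theorem cliqueCoverNumber_eq_and_thetaRank_eq_zero {V : Type*} [Fintype V] [DecidableEq V]
    (G : SimpleGraph V) [DecidableRel G.Adj] (h : Gᶜ.Colorable G.indepNum) :
    ThetaRank.cliqueCoverNumber G = (G.indepNum : ℕ∞) ∧ ThetaRank.thetaRank G = 0 := by
  constructor
  · refine le_antisymm h.chromaticNumber_le ?_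
    obtain ⟨S, hS⟩ := G.exists_isNIndepSet_indepNum
    have hc : Gᶜ.IsClique (S : Set V) := (SimpleGraph.isClique_compl G).2 hS.isIndepSet
    rw [← hS.card_eq]
    exact hc.card_le_chromaticNumber
  · have hb : ThetaRank.thetaBound G 0 = G.indepNum := by
      unfold ThetaRank.thetaBound
      cases isEmpty_or_nonempty V with
      | inl hV =>
        -- without vertices every real `t` is feasible, and the infimum of all reals is `0`
        have h0 : G.indepNum = 0 := by
          obtain ⟨S, hS⟩ := G.exists_isNIndepSet_indepNum
          rw [← hS.card_eq, Finset.card_eq_zero]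
          exact Finset.eq_empty_of_isEmpty S
        have : {t : ℝ | t • (G.adjMatrix ℝ + 1) - Matrix.of (fun _ _ => (1 : ℝ)) ∈
            ThetaRank.parriloCone V 0} = Set.univ := by
          refine Set.eq_univ_of_forall fun t => ⟨Matrix.IsSymm.ext fun i => isEmptyElim i, ?_⟩
          simp [ThetaRank.squareForm]
        rw [this, h0]
        simp
      | inr hV =>
        refine le_antisymm (csInf_le ⟨G.indepNum, fun t ht => ?_⟩ ?_)
          (le_csInf ⟨G.indepNum, ?_⟩ fun t ht => ?_)
        · exact indepNum_le_of_mem_parriloCone G ht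
        · exact mem_parriloCone_of_compl_coloring G h.some
        · exact mem_parriloCone_of_compl_coloring G h.some
        · exact indepNum_le_of_mem_parriloCone G ht
    unfold ThetaRank.thetaRank
    exact nonpos_iff_eq_zero.1
      (iInf_le (fun r : {r : ℕ // ThetaRank.thetaBound G r = (G.indepNum : ℝ)} =>
        ((r : ℕ) : ℕ∞)) ⟨0, hb⟩)

/-! ### The 5-cycle with isolated nodes -/

/-- A doubly nonnegative matrix on `C₅` plus `m` isolated nodes that vanishes on the edges, with
entry sum larger than `m + 2` times its trace. The optimal such matrix attains the ratio `m + √5`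
and has irrational entries; a smaller ratio is enough here. Nodes of `C₅` are adjacent when they
differ by `1` modulo `5`. -/
def fiveCycleWeight (m : ℕ) : Fin 5 ⊕ Fin m → Fin 5 ⊕ Fin m → ℝ
  | .inl a, .inl b => if a = b then 55 else if a = b + 1 ∨ b = a + 1 then 0 else 33
  | .inl _, .inr _ => 55
  | .inr _, .inl _ => 55
  | .inr _, .inr _ => 125

theorem cycleGraph_five_adj (a b : Fin 5) :
    (SimpleGraph.cycleGraph 5).Adj a b ↔ a = b + 1 ∨ b = a + 1 := by
  revert a b
  decide

theorem fiveCycleWeight_nonneg (m : ℕ) (x y : Fin 5 ⊕ Fin m) : 0 ≤ fiveCycleWeight m x y := by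
  rcases x with a | a <;> rcases y with b | b <;> simp only [fiveCycleWeight] <;>
    (try split_ifs) <;> norm_num

theorem fiveCycleWeight_posSemidef (m : ℕ) (u : Fin 5 ⊕ Fin m → ℝ) :
    0 ≤ ∑ x, ∑ y, u x * u y * fiveCycleWeight m x y := by
  simp only [Fintype.sum_sum_type, fiveCycleWeight, ← Finset.sum_mul, ← Finset.mul_sum,
    Finset.sum_add_distrib]
  generalize ∑ i, u (.inr i) = z
  simp only [Fin.sum_univ_five, Fin.isValue, Fin.reduceAdd, Fin.reduceEq, if_true, if_false,
    or_true, true_or, or_self]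
  generalize u (.inl 0) = a
  generalize u (.inl 1) = b
  generalize u (.inl 2) = c
  generalize u (.inl 3) = d
  generalize u (.inl 4) = e
  -- complete the square in `z`; the rest is a form in the differences around the cycle
  have key : ∀ p q r s t : ℝ, p + q + r + s + t = 0 →
      0 ≤ 3 * (p ^ 2 + q ^ 2 + r ^ 2 + s ^ 2 + t ^ 2) -
        8 * (p * q + q * r + r * s + s * t + t * p) := by
    intro p q r s t h
    have ht : t = -(p + q + r + s) := by linarith
    subst ht
    nlinarith [sq_nonneg (p - q + (p + q + r + s)), sq_nonneg (q - r - p), sq_nonneg (r - s - q),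
      sq_nonneg (s + (p + q + r + s) - r), sq_nonneg ((p + q + r + s) + p + s),
      sq_nonneg p, sq_nonneg q, sq_nonneg r, sq_nonneg s, sq_nonneg (p + q + r + s)]
  have := key (a - b) (b - c) (c - d) (d - e) (e - a) (by ring)
  nlinarith [sq_nonneg (125 * z + 55 * (a + b + c + d + e))]

/-- Pairing with `fiveCycleWeight` separates `ϑ⁽⁰⁾` from the stability number. -/
theorem one_le_thetaRank_of_isC5PlusIsolated {V : Type*} [Fintype V] [DecidableEq V]
    (G : SimpleGraph V) [DecidableRel G.Adj] (h : ThetaRank.IsC5PlusIsolated G)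
    (hcard : Fintype.card V = G.indepNum + 3) : 1 ≤ ThetaRank.thetaRank G := by
  obtain ⟨m, ⟨e⟩⟩ := h
  have hm : G.indepNum = m + 2 := by
    have := Fintype.card_congr e.toEquiv
    simp at this
    omega
  have hfeas : ∀ t : ℝ, t • (G.adjMatrix ℝ + 1) - Matrix.of (fun _ _ => (1 : ℝ)) ∈
      ThetaRank.parriloCone V 0 → 605 + 550 * (m : ℝ) + 125 * m ^ 2 ≤ t * (275 + 125 * m) := by
    intro t ht
    have hs : ∀ F : Fin 5 ⊕ Fin m → Fin 5 ⊕ Fin m → ℝ,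
        ∑ i, ∑ j, F (e i) (e j) = ∑ x, ∑ y, F x y := by
      intro F
      rw [← e.toEquiv.sum_comp]
      exact Finset.sum_congr rfl fun i _ => e.toEquiv.sum_comp (F (e i))
    have h := sum_mul_nonneg_of_mem_parriloCone_zero
      (Y := fun i j => fiveCycleWeight m (e i) (e j))
      (fun i j _ => fiveCycleWeight_nonneg m _ _)
      (fun u => by
        have := fiveCycleWeight_posSemidef m (u ∘ e.symm)
        rw [← hs] at this
        simpa using this) ht
    -- on edges both sides vanish with the weight
    have hM : ∀ i j, (t • (G.adjMatrix ℝ + 1) - Matrix.of (fun _ _ => (1 : ℝ)) : Matrix V V ℝ) i j *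
        fiveCycleWeight m (e i) (e j) =
        ((if e i = e j then t else 0) - 1) * fiveCycleWeight m (e i) (e j) := by
      intro i j
      by_cases hadj : G.Adj i j
      · have h0 : fiveCycleWeight m (e i) (e j) = 0 := by
          have hadj' := e.map_rel_iff.2 hadj
          have hne := hadj'.ne
          rcases hx : e i with a | a <;> rcases hy : e j with b | b <;> rw [hx, hy] at hadj' hne
          · rw [SimpleGraph.sum_adj_inl, cycleGraph_five_adj] at hadj'
            have : a ≠ b := fun h => hne (congrArg _ h)
            simp [fiveCycleWeight, this, hadj']
          all_goals simp at hadj'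
        simp [h0]
      · simp [hadj, Matrix.one_apply, e.injective.eq_iff]
    simp only [hM] at h
    rw [hs fun x y => ((if x = y then t else 0) - 1) * fiveCycleWeight m x y] at h
    simp only [sub_mul, one_mul, ite_mul, zero_mul, Finset.sum_sub_distrib, Finset.sum_ite_eq,
      Finset.mem_univ, if_true, Fintype.sum_sum_type, fiveCycleWeight, Fin.sum_univ_five,
      Fin.isValue, Fin.reduceAdd, Fin.reduceEq, if_false, or_true, true_or, or_self,
      Finset.sum_const, Finset.card_univ, Fintype.card_fin, nsmul_eq_mul,
      Finset.sum_add_distrib] at h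
    push_cast at h
    linarith
  have hb : ThetaRank.thetaBound G 0 ≠ G.indepNum := by
    unfold ThetaRank.thetaBound
    rw [hm]
    push_cast
    rcases Set.eq_empty_or_nonempty {t : ℝ | t • (G.adjMatrix ℝ + 1) -
        Matrix.of (fun _ _ => (1 : ℝ)) ∈ ThetaRank.parriloCone V 0} with hE | hE
    · -- the infimum of the empty set is `0`, which is not `m + 2` either
      rw [hE, Real.sInf_empty]
      positivity
    · have hpos : (0 : ℝ) < 275 + 125 * m := by positivity
      have hle := le_csInf hE fun t ht => (div_le_iff₀ hpos).2 (hfeas t ht)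
      have hlt : (m : ℝ) + 2 < (605 + 550 * (m : ℝ) + 125 * m ^ 2) / (275 + 125 * m) := by
        rw [lt_div_iff₀ hpos]
        nlinarith [(Nat.cast_nonneg m : (0 : ℝ) ≤ m)]
      exact (hlt.trans_le hle).ne'
  unfold ThetaRank.thetaRank
  refine le_iInf fun ⟨r, hr⟩ => ?_
  rcases Nat.eq_zero_or_pos r with rfl | hr'
  · exact absurd hr hb
  · exact_mod_cast hr'

/-! ### Critical edges -/

/-- Deleting an edge raises the stability number by at most one: drop one endpoint. -/
theorem indepNum_deleteEdges_le {V : Type*} [Fintype V] (G : SimpleGraph V) (e : Sym2 V) :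
    (G.deleteEdges {e}).indepNum ≤ G.indepNum + 1 := by
  classical
  obtain ⟨S, hS⟩ := (G.deleteEdges {e}).exists_isNIndepSet_indepNum
  rw [← hS.card_eq]
  induction e with | _ v w
  have : G.IsIndepSet (S.erase v : Finset V) := by
    intro x hx y hy hxy hadj
    simp only [Finset.coe_erase, Set.mem_sdiff, Finset.mem_coe, Set.mem_singleton_iff] at hx hy
    refine hS.isIndepSet hx.1 hy.1 hxy ?_
    rw [SimpleGraph.deleteEdges_adj]
    refine ⟨hadj, ?_⟩
    simp [hx.2, hy.2]
  have h1 := this.card_le_indepNum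
  have h2 := Finset.pred_card_le_card_erase (s := S) (a := v)
  omega

theorem isCriticalEdge_of_isIndepSet_deleteEdges {V : Type*} [Fintype V] {G : SimpleGraph V}
    {e : Sym2 V} (he : e ∈ G.edgeSet) {S : Finset V} (hS : (G.deleteEdges {e}).IsIndepSet S)
    (hcard : G.indepNum + 1 ≤ S.card) : ThetaRank.IsCriticalEdge G e :=
  ⟨he, le_antisymm (indepNum_deleteEdges_le G e) (hcard.trans hS.card_le_indepNum)⟩

theorem isCritical_of_isC5PlusIsolated {V : Type*} [Fintype V] {G : SimpleGraph V}
    (h : ThetaRank.IsC5PlusIsolated G) (hcard : Fintype.card V = G.indepNum + 3) :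
    ThetaRank.IsCritical G := by
  classical
  obtain ⟨m, ⟨e⟩⟩ := h
  have hm : G.indepNum = m + 2 := by
    have := Fintype.card_congr e.toEquiv
    simp at this
    omega
  -- the ends of an edge of `C₅` and the opposite node are pairwise nonadjacent up to that edge
  have key : ∀ a b : Fin 5, (SimpleGraph.cycleGraph 5).Adj a b → ∃ S : Finset (Fin 5), S.card = 3 ∧
      ∀ x ∈ S, ∀ y ∈ S, (SimpleGraph.cycleGraph 5).Adj x y → (x = a ∧ y = b) ∨ (x = b ∧ y = a) := by
    decide
  intro ed hed
  induction ed with | _ v w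
  have hadj : G.Adj v w := hed
  have hadj' := e.map_rel_iff.2 hadj
  rcases hv : e v with a | a <;> rcases hw : e w with b | b <;> rw [hv, hw] at hadj'
  · rw [SimpleGraph.sum_adj_inl] at hadj'
    obtain ⟨S, hS3, hS⟩ := key a b hadj'
    refine isCriticalEdge_of_isIndepSet_deleteEdges hed
      (S := (S.disjSum Finset.univ).map e.symm.toEquiv.toEmbedding) ?_ ?_
    · intro x hx y hy hxy hadjxy
      rw [SimpleGraph.deleteEdges_adj] at hadjxy
      obtain ⟨hG, hne⟩ := hadjxy
      simp only [Finset.coe_map, Set.mem_image, Finset.mem_coe, Finset.mem_disjSum] at hx hy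
      obtain ⟨x', hx', rfl⟩ := hx
      obtain ⟨y', hy', rfl⟩ := hy
      have hG' := e.map_rel_iff.2 hG
      have ex : e (e.symm.toEquiv.toEmbedding x') = x' := e.apply_symm_apply x'
      have ey : e (e.symm.toEquiv.toEmbedding y') = y' := e.apply_symm_apply y'
      rw [ex, ey] at hG'
      rcases hx' with ⟨p, hp, rfl⟩ | ⟨p, -, rfl⟩ <;> rcases hy' with ⟨q, hq, rfl⟩ | ⟨q, -, rfl⟩
      · rw [SimpleGraph.sum_adj_inl] at hG'
        have hv' : v = e.symm (.inl a) := by rw [← hv, e.symm_apply_apply]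
        have hw' : w = e.symm (.inl b) := by rw [← hw, e.symm_apply_apply]
        apply hne
        rcases hS p hp q hq hG' with ⟨rfl, rfl⟩ | ⟨rfl, rfl⟩
        · rw [hv', hw']; rfl
        · rw [hv', hw', Sym2.eq_swap]; rfl
      all_goals simp at hG'
    · rw [Finset.card_map, Finset.card_disjSum, hS3, Finset.card_univ, Fintype.card_fin]
      omega
  all_goals simp at hadj'

/-! ### Clique covers that extend a stable set -/

/-- The vertices of `T` can be distributed over the vertices of `S` so that each `s ∈ S` together
with the vertices assigned to it is a clique. -/
def IsCliqueAssignable {V : Type*} (G : SimpleGraph V) (S T : Finset V) : Prop :=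
  ∃ f : V → V, (∀ v ∈ T, f v ∈ S ∧ G.Adj v (f v)) ∧
    ∀ u ∈ T, ∀ v ∈ T, u ≠ v → f u = f v → G.Adj u v

theorem IsCliqueAssignable.compl_colorable {V : Type*} [Fintype V] [DecidableEq V]
    {G : SimpleGraph V} {S : Finset V} (h : IsCliqueAssignable G S Sᶜ) :
    Gᶜ.Colorable S.card := by
  obtain ⟨f, hf, hadj⟩ := h
  let K : Gᶜ.Coloring S := SimpleGraph.Coloring.mk
    (fun v => if hv : v ∈ S then ⟨v, hv⟩ else ⟨f v, (hf v (Finset.mem_compl.2 hv)).1⟩) (by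
      intro v w hvw heq
      rw [SimpleGraph.compl_adj] at hvw
      obtain ⟨hne, hnadj⟩ := hvw
      by_cases hv : v ∈ S <;> by_cases hw : w ∈ S <;>
        simp only [hv, hw, dif_pos, not_false_eq_true, dif_neg, Subtype.mk.injEq] at heq
      · exact hne heq
      · exact hnadj (heq ▸ (hf w (Finset.mem_compl.2 hw)).2.symm)
      · exact hnadj (heq ▸ (hf v (Finset.mem_compl.2 hv)).2)
      · exact hnadj (hadj v (Finset.mem_compl.2 hv) w (Finset.mem_compl.2 hw) hne heq))
  simpa using K.colorable

section

variable {V : Type*} [Fintype V] [DecidableEq V] {G : SimpleGraph V} [DecidableRel G.Adj]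
  {S T : Finset V}

/-- Hall's condition: exchanging the neighbours in a maximum stable set `S` of a stable set `W`
outside `S` for `W` itself yields a stable set. -/
theorem card_le_card_biUnion_adj (hS : G.IsNIndepSet G.indepNum S) {W : Finset V}
    (hW : G.IsIndepSet (W : Set V)) (hWS : Disjoint W S) :
    W.card ≤ (W.biUnion fun v => S.filter (G.Adj v)).card := by
  set N := W.biUnion fun v => S.filter (G.Adj v) with hN
  have hNS : N ⊆ S := Finset.biUnion_subset.2 fun v _ => Finset.filter_subset _ _
  have hR : G.IsIndepSet ((S \ N ∪ W : Finset V) : Set V) := by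
    intro x hx y hy hxy hadj
    simp only [Finset.coe_union, Finset.coe_sdiff, Set.mem_union, Set.mem_sdiff,
      Finset.mem_coe] at hx hy
    have hout : ∀ p q, p ∈ S → p ∉ N → q ∈ W → ¬ G.Adj q p := fun p q hp hpN hq hqp =>
      hpN (Finset.mem_biUnion.2 ⟨q, hq, Finset.mem_filter.2 ⟨hp, hqp⟩⟩)
    rcases hx with hx | hx <;> rcases hy with hy | hy
    · exact hS.isIndepSet hx.1 hy.1 hxy hadj
    · exact hout x y hx.1 hx.2 hy hadj.symm
    · exact hout y x hy.1 hy.2 hx hadj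
    · exact hW hx hy hxy hadj
  have h1 := hR.card_le_indepNum
  rw [Finset.card_union_of_disjoint (hWS.symm.mono_left Finset.sdiff_subset),
    Finset.card_sdiff_of_subset hNS, ← hS.card_eq] at h1
  have := Finset.card_le_card hNS
  omega

/-- Hall's theorem matches a stable set outside a maximum stable set `S` into `S`. -/
theorem isCliqueAssignable_of_isIndepSet (hS : G.IsNIndepSet G.indepNum S)
    (hT : G.IsIndepSet (T : Set V)) (hTS : Disjoint T S) : IsCliqueAssignable G S T := by
  have hall : ∀ W : Finset T, W.card ≤ (W.biUnion fun v : T => S.filter (G.Adj v)).card := by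
    intro W
    have hsub : W.map (Function.Embedding.subtype _) ⊆ T := by
      intro x hx
      obtain ⟨y, -, rfl⟩ := Finset.mem_map.1 hx
      exact y.2
    have := card_le_card_biUnion_adj hS (hT.mono (Finset.coe_subset.2 hsub))
      (hTS.mono_left hsub)
    rw [Finset.card_map, Finset.map_eq_image, Finset.image_biUnion] at this
    exact this
  obtain ⟨f, hinj, hf⟩ :=
    (Finset.all_card_le_biUnion_card_iff_exists_injective
      fun v : T => S.filter (G.Adj v)).1 hall
  refine ⟨fun v => if h : v ∈ T then f ⟨v, h⟩ else v, fun v hv => ?_, fun u hu v hv hne heq => ?_⟩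
  · simpa [hv] using hf ⟨v, hv⟩
  · simp only [hu, hv, dif_pos] at heq
    exact absurd (congrArg Subtype.val (hinj heq)) hne

omit [Fintype V] in
/-- Greedy extension: a vertex with more neighbours in `S` than nonneighbours in `T` can be
assigned last. -/
theorem IsCliqueAssignable.of_erase {v : V} (h : IsCliqueAssignable G S (T.erase v))
    (hv : (T.filter fun u => u ≠ v ∧ ¬ G.Adj u v).card < (S.filter (G.Adj v)).card) :
    IsCliqueAssignable G S T := by
  obtain ⟨f, hf, hadj⟩ := h
  obtain ⟨s, hs, hs'⟩ := Finset.exists_mem_notMem_of_card_lt_card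
    ((Finset.card_image_le (f := f)).trans_lt hv)
  rw [Finset.mem_filter] at hs
  have hs'' : ∀ u ∈ T, u ≠ v → f u = s → G.Adj u v := by
    intro u hu hne hfu
    by_contra hnadj
    exact hs' (Finset.mem_image.2 ⟨u, Finset.mem_filter.2 ⟨hu, hne, hnadj⟩, hfu⟩)
  refine ⟨Function.update f v s, fun u hu => ?_, fun u hu w hw hne heq => ?_⟩
  · by_cases huv : u = v
    · subst huv
      simpa using hs
    · simpa [huv] using hf u (Finset.mem_erase.2 ⟨huv, hu⟩)
  · by_cases huv : u = v <;> by_cases hwv : w = v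
    · exact absurd (huv.trans hwv.symm) hne
    · subst huv
      simp only [Function.update_self, Function.update_of_ne hwv] at heq
      exact (hs'' w hw hwv heq.symm).symm
    · subst hwv
      simp only [Function.update_self, Function.update_of_ne huv] at heq
      exact hs'' u hu huv heq
    · simp only [Function.update_of_ne huv, Function.update_of_ne hwv] at heq
      exact hadj u (Finset.mem_erase.2 ⟨huv, hu⟩) w (Finset.mem_erase.2 ⟨hwv, hw⟩) hne heq

theorem one_le_card_filter_adj (hS : G.IsNIndepSet G.indepNum S) {v : V} (hv : v ∉ S) :
    1 ≤ (S.filter (G.Adj v)).card := by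
  simpa using card_le_card_biUnion_adj hS (W := {v}) (by simp) (by simpa using hv)

theorem two_le_card_union_filter_adj (hS : G.IsNIndepSet G.indepNum S) {u v : V} (hu : u ∉ S)
    (hv : v ∉ S) (hne : u ≠ v) (huv : ¬ G.Adj u v) :
    2 ≤ (S.filter (G.Adj u) ∪ S.filter (G.Adj v)).card := by
  have := card_le_card_biUnion_adj hS (W := {u, v})
    (by simp [Set.pairwise_insert, huv, G.adj_comm v u])
    (by simp [hu, hv])
  simpa [hne, Finset.biUnion_insert] using this

theorem three_le_card_union_filter_adj (hS : G.IsNIndepSet G.indepNum S) {u v w : V} (hu : u ∉ S)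
    (hv : v ∉ S) (hw : w ∉ S) (huv : u ≠ v) (huw : u ≠ w) (hvw : v ≠ w) (auv : ¬ G.Adj u v)
    (auw : ¬ G.Adj u w) (avw : ¬ G.Adj v w) :
    3 ≤ (S.filter (G.Adj u) ∪ (S.filter (G.Adj v) ∪ S.filter (G.Adj w))).card := by
  have := card_le_card_biUnion_adj hS (W := {u, v, w})
    (by simp [Set.pairwise_insert, auv, auw, avw, G.adj_comm v u, G.adj_comm w u, G.adj_comm w v])
    (by simp [hu, hv, hw])
  simpa [huv, huw, hvw, Finset.biUnion_insert] using this

theorem exists_adj_of_not_isCliqueAssignable (hS : G.IsNIndepSet G.indepNum S)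
    (hTS : Disjoint T S) (h : ¬ IsCliqueAssignable G S T) : ∃ a ∈ T, ∃ b ∈ T, G.Adj a b := by
  by_contra! hno
  exact h (isCliqueAssignable_of_isIndepSet hS (fun a ha b hb _ => hno a ha b hb) hTS)

theorem isCliqueAssignable_of_card_le_two (hS : G.IsNIndepSet G.indepNum S) (hTS : Disjoint T S)
    (hT : T.card ≤ 2) : IsCliqueAssignable G S T := by
  by_contra h
  obtain ⟨a, ha, b, hb, hab⟩ := exists_adj_of_not_isCliqueAssignable hS hTS h
  have hTab : {a, b} = T := Finset.eq_of_subset_of_card_le (by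
    simp [Finset.insert_subset_iff, ha, hb]) (by rw [Finset.card_pair hab.ne]; exact hT)
  subst hTab
  refine h (IsCliqueAssignable.of_erase (v := a) ?_ ?_)
  · exact isCliqueAssignable_of_isIndepSet hS 
      (Set.Subsingleton.pairwise (fun x hx y hy => by simp_all) _)
      (hTS.mono_left (Finset.erase_subset _ _))
  · rw [Finset.card_eq_zero.2]
    · exact one_le_card_filter_adj hS (Finset.disjoint_left.1 hTS ha)
    · refine Finset.filter_eq_empty_iff.2 fun x hx hx' => ?_
      simp only [Finset.mem_insert, Finset.mem_singleton] at hx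
      rcases hx with rfl | rfl
      · exact hx'.1 rfl
      · exact hx'.2 hab.symm

/-- For three vertices outside a maximum stable set the only obstruction is that they span a
single edge `a b`, that `a` and `b` have unique and distinct neighbours `x` and `y` in `S`, and
that the neighbours in `S` of the third vertex are exactly `x` and `y`. -/
theorem isCliqueAssignable_or_of_card_eq_three (hS : G.IsNIndepSet G.indepNum S)
    (hTS : Disjoint T S) (hT : T.card = 3) : IsCliqueAssignable G S T ∨
      ∃ a b c x y, T = {a, b, c} ∧ x ∈ S ∧ y ∈ S ∧ x ≠ y ∧ G.Adj a b ∧ ¬ G.Adj a c ∧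
        ¬ G.Adj b c ∧ (∀ s ∈ S, G.Adj a s ↔ s = x) ∧ (∀ s ∈ S, G.Adj b s ↔ s = y) ∧
        ∀ s ∈ S, G.Adj c s ↔ s = x ∨ s = y := by
  by_contra hcon
  rw [not_or] at hcon
  obtain ⟨h, hcon⟩ := hcon
  apply hcon
  obtain ⟨a, ha, b, hb, hab⟩ := exists_adj_of_not_isCliqueAssignable hS hTS h
  obtain ⟨c, hc, hca, hcb⟩ : ∃ c ∈ T, c ≠ a ∧ c ≠ b := by
    obtain ⟨c, hc, hc'⟩ := Finset.exists_mem_notMem_of_card_lt_card (s := {a, b}) (t := T)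
      (by rw [Finset.card_pair hab.ne, hT]; norm_num)
    simp only [Finset.mem_insert, Finset.mem_singleton, not_or] at hc'
    exact ⟨c, hc, hc'⟩
  have hTabc : T = {a, b, c} := (Finset.eq_of_subset_of_card_le (by
    simp [Finset.insert_subset_iff, ha, hb, hc]) (by
      rw [Finset.card_eq_three.2 ⟨a, b, c, hab.ne, hca.symm, hcb.symm, rfl⟩, hT])).symm
  have haS := Finset.disjoint_left.1 hTS ha
  have hbS := Finset.disjoint_left.1 hTS hb
  have hcS := Finset.disjoint_left.1 hTS hc
  have hmem : ∀ u, u ∈ T ↔ u = a ∨ u = b ∨ u = c := by simp [hTabc]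
  -- by greedy extension no vertex has more neighbours in `S` than nonneighbours in `T`
  have hgreedy : ∀ v ∈ T, ∀ W : Finset V, (∀ u ∈ T, u ≠ v → ¬ G.Adj u v → u ∈ W) →
      (S.filter (G.Adj v)).card ≤ W.card := by
    intro v hv W hW
    by_contra! hlt
    refine h (IsCliqueAssignable.of_erase (isCliqueAssignable_of_card_le_two hS
      (hTS.mono_left (Finset.erase_subset _ _)) (by rw [Finset.card_erase_of_mem hv, hT]))
      ((Finset.card_le_card fun u hu => ?_).trans_lt hlt))
    rw [Finset.mem_filter] at hu
    exact hW u hu.1 hu.2.1 hu.2.2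
  have h1a := one_le_card_filter_adj hS haS
  have h1b := one_le_card_filter_adj hS hbS
  have hac : ¬ G.Adj a c := by
    intro hac
    have := hgreedy a ha ∅ fun u hu hne hnadj => by
      rcases (hmem u).1 hu with rfl | rfl | rfl
      · exact absurd rfl hne
      · exact absurd hab.symm hnadj
      · exact absurd hac.symm hnadj
    rw [Finset.card_empty] at this
    omega
  have hbc : ¬ G.Adj b c := by
    intro hbc
    have := hgreedy b hb ∅ fun u hu hne hnadj => by
      rcases (hmem u).1 hu with rfl | rfl | rfl
      · exact absurd hab hnadj
      · exact absurd rfl hne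
      · exact absurd hbc.symm hnadj
    rw [Finset.card_empty] at this
    omega
  have hLa : (S.filter (G.Adj a)).card = 1 := by
    refine le_antisymm (hgreedy a ha {c} fun u hu hne hnadj => ?_) h1a
    rcases (hmem u).1 hu with rfl | rfl | rfl
    · exact absurd rfl hne
    · exact absurd hab.symm hnadj
    · simp
  have hLb : (S.filter (G.Adj b)).card = 1 := by
    refine le_antisymm (hgreedy b hb {c} fun u hu hne hnadj => ?_) h1b
    rcases (hmem u).1 hu with rfl | rfl | rfl
    · exact absurd hab hnadj
    · exact absurd rfl hne
    · simp
  have hUa := two_le_card_union_filter_adj hS haS hcS hca.symm hac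
  have hUb := two_le_card_union_filter_adj hS hbS hcS hcb.symm hbc
  obtain ⟨x, hx⟩ := Finset.card_eq_one.1 hLa
  obtain ⟨y, hy⟩ := Finset.card_eq_one.1 hLb
  have hx' : ∀ s, s ∈ S ∧ G.Adj a s ↔ s = x := fun s => by
    rw [← Finset.mem_filter, hx, Finset.mem_singleton]
  have hy' : ∀ s, s ∈ S ∧ G.Adj b s ↔ s = y := fun s => by
    rw [← Finset.mem_filter, hy, Finset.mem_singleton]
  obtain ⟨hxS, hax⟩ := (hx' x).2 rfl
  obtain ⟨hyS, hby⟩ := (hy' y).2 rfl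
  have hsecond : ∀ z : V, 2 ≤ ({z} ∪ S.filter (G.Adj c)).card → ∃ w ∈ S, G.Adj c w ∧ w ≠ z := by
    intro z hz
    by_contra! hno
    have : ({z} ∪ S.filter (G.Adj c)) ⊆ {z} := by
      refine Finset.union_subset subset_rfl fun w hw => ?_
      rw [Finset.mem_filter] at hw
      exact Finset.mem_singleton.2 (hno w hw.1 hw.2)
    have := Finset.card_le_card this
    rw [Finset.card_singleton] at this
    omega
  obtain ⟨z, hzS, hcz, hzx⟩ := hsecond x (hx ▸ hUa)
  obtain ⟨w, hwS, hcw, hwy⟩ := hsecond y (hy ▸ hUb)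
  -- a neighbour of `c` other than `x` and `y` would give an assignment
  have hcxy : ∀ s ∈ S, G.Adj c s → s ≠ x → s = y := by
    intro s hs hcs hsx
    by_contra hsy
    refine h ⟨fun v => if v = a then x else if v = b then y else s, fun v hv => ?_,
      fun u hu v hv hne heq => ?_⟩
    · rcases (hmem v).1 hv with rfl | rfl | rfl
      · simpa using ⟨hxS, hax⟩
      · simpa [hab.ne'] using ⟨hyS, hby⟩
      · simpa [hca, hcb] using ⟨hs, hcs⟩
    · rcases (hmem u).1 hu with rfl | rfl | rfl <;> rcases (hmem v).1 hv with rfl | rfl | rfl <;>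
        grind [hab.symm]
  have hzy : z = y := hcxy z hzS hcz hzx
  subst hzy
  have hwx : w = x := by
    by_contra hwx
    exact hwy (hcxy w hwS hcw hwx)
  subst hwx
  refine ⟨a, b, c, w, z, hTabc, hxS, hyS, hzx.symm, hab, hac, hbc, fun s hs => ?_, fun s hs => ?_,
    fun s hs => ⟨fun hcs => ?_, ?_⟩⟩
  · simpa [hs] using hx' s
  · simpa [hs] using hy' s
  · by_contra! hne
    exact hne.2 (hcxy s hs hcs hne.1)
  · rintro (rfl | rfl)
    · exact hcw
    · exact hcz

omit [DecidableEq V] [DecidableRel G.Adj] in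
theorem isC5PlusIsolated_of_induced_cycle (g : Fin 5 → V)
    (hg : ∀ i j, G.Adj (g i) (g j) ↔ (SimpleGraph.cycleGraph 5).Adj i j)
    (hiso : ∀ v, v ∉ Set.range g → ∀ w, ¬ G.Adj v w) : ThetaRank.IsC5PlusIsolated G := by
  classical
  -- nodes of `C₅` are determined by their neighbourhoods
  have hinj : Function.Injective g := by
    have key : ∀ i j : Fin 5, (∀ k, (SimpleGraph.cycleGraph 5).Adj i k ↔
        (SimpleGraph.cycleGraph 5).Adj j k) → i = j := by decide
    intro i j hij
    exact key i j fun k => by rw [← hg, ← hg, hij]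
  let e : Fin 5 ⊕ Fin (Fintype.card ↥(Set.range g)ᶜ) ≃ V :=
    ((Equiv.ofInjective g hinj).sumCongr (Fintype.equivFin ↥(Set.range g)ᶜ).symm).trans
      (Equiv.Set.sumCompl (Set.range g))
  have hl : ∀ i, e (.inl i) = g i := fun i => rfl
  have hr : ∀ i, e (.inr i) ∉ Set.range g := fun i =>
    ((Fintype.equivFin ↥(Set.range g)ᶜ).symm i).2
  refine ⟨_, ⟨RelIso.symm ⟨e, ?_⟩⟩⟩
  rintro (i | i) (j | j)
  · rw [hl, hl, hg, SimpleGraph.sum_adj_inl]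
  · rw [G.adj_comm]
    simpa using hiso _ (hr j) _
  · simpa using hiso _ (hr i) _
  · simpa using hiso _ (hr i) _

theorem isCliqueAssignable_compl_of_card_eq_three (hS : G.IsNIndepSet G.indepNum S)
    (hT : Sᶜ.card = 3) (h : ¬ ThetaRank.IsC5PlusIsolated G) : IsCliqueAssignable G S Sᶜ := by
  rcases isCliqueAssignable_or_of_card_eq_three hS disjoint_compl_left hT with h' | h'
  · exact h'
  obtain ⟨a, b, c, x, y, hTabc, hxS, hyS, hxy, hab, hac, hbc, hax, hby, hcxy⟩ := h'
  refine absurd (isC5PlusIsolated_of_induced_cycle ![a, b, y, c, x] ?_ ?_) h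
  · have h1 := (hax x hxS).2 rfl
    have h2 := (hby y hyS).2 rfl
    have h3 := (hcxy x hxS).2 (.inl rfl)
    have h4 := (hcxy y hyS).2 (.inr rfl)
    have h5 : ¬ G.Adj a y := fun h => hxy ((hax y hyS).1 h).symm
    have h6 : ¬ G.Adj b x := fun h => hxy ((hby x hxS).1 h)
    have h7 : ¬ G.Adj x y := hS.isIndepSet hxS hyS hxy
    intro i j
    rw [cycleGraph_five_adj]
    fin_cases i <;> fin_cases j <;>
      simp [hab, hac, hbc, h1, h2, h3, h4, h5, h6, h7, hab.symm, h1.symm, h2.symm, h3.symm,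
        h4.symm, G.adj_comm c a, G.adj_comm c b, G.adj_comm y a, G.adj_comm x b, G.adj_comm y x]
  · intro v hv w hvw
    have hv' : v ≠ a ∧ v ≠ b ∧ v ≠ y ∧ v ≠ c ∧ v ≠ x := by
      refine ⟨?_, ?_, ?_, ?_, ?_⟩ <;> rintro rfl <;> simp at hv
    obtain ⟨hva, hvb, hvy, hvc, hvx⟩ := hv'
    have hmem : ∀ u, u ∉ S ↔ u = a ∨ u = b ∨ u = c := fun u => by
      rw [← Finset.mem_compl, hTabc]
      simp
    have hvS : v ∈ S := by
      by_contra hvS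
      rcases (hmem v).1 hvS with rfl | rfl | rfl <;> contradiction
    have hwS : w ∉ S := fun hwS => hS.isIndepSet hvS hwS hvw.ne hvw
    rcases (hmem w).1 hwS with rfl | rfl | rfl
    · exact hvx ((hax v hvS).1 hvw.symm)
    · exact hvy ((hby v hvS).1 hvw.symm)
    · exact ((hcxy v hvS).1 hvw.symm).elim hvx hvy

/-! ### Acritical graphs -/

/-- If `v` had a unique neighbour `s` in the maximum stable set `S`, then `S ∪ {v}` would be stable
after deleting the edge `v s`. -/
theorem two_le_card_filter_adj_of_isAcritical (hG : ThetaRank.IsAcritical G)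
    (hS : G.IsNIndepSet G.indepNum S) {v : V} (hv : v ∉ S) : 2 ≤ (S.filter (G.Adj v)).card := by
  by_contra! hlt
  have h1 := one_le_card_filter_adj hS hv
  obtain ⟨s, hs⟩ := Finset.card_eq_one.1 (by omega : (S.filter (G.Adj v)).card = 1)
  have hs' : ∀ u, u ∈ S ∧ G.Adj v u ↔ u = s := fun u => by
    rw [← Finset.mem_filter, hs, Finset.mem_singleton]
  obtain ⟨hsS, hvs⟩ := (hs' s).2 rfl
  refine hG s(v, s) hvs (isCriticalEdge_of_isIndepSet_deleteEdges hvs (S := insert v S) ?_ ?_)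
  · have key : ∀ u ∈ S, ¬ (G.deleteEdges {s(v, s)}).Adj v u := by
      intro u hu hadj
      rw [SimpleGraph.deleteEdges_adj] at hadj
      exact hadj.2 (by rw [(hs' u).1 ⟨hu, hadj.1⟩]; rfl)
    rw [Finset.coe_insert]
    refine Set.pairwise_insert.2 ⟨fun x hx y hy hxy hadj => ?_,
      fun u hu _ => ⟨key u hu, fun h => key u hu h.symm⟩⟩
    rw [SimpleGraph.deleteEdges_adj] at hadj
    exact hS.isIndepSet hx hy hxy hadj.1
  · rw [Finset.card_insert_of_notMem hv, hS.card_eq]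

theorem isCliqueAssignable_of_card_eq_three_of_two_le (hS : G.IsNIndepSet G.indepNum S)
    (hTS : Disjoint T S) (hT : T.card = 3) (hL : ∀ v ∈ T, 2 ≤ (S.filter (G.Adj v)).card) :
    IsCliqueAssignable G S T := by
  rcases isCliqueAssignable_or_of_card_eq_three hS hTS hT with h | h
  · exact h
  · obtain ⟨a, b, c, x, y, rfl, -, -, -, -, -, -, hax, -⟩ := h
    have h2 := hL a (by simp)
    have : S.filter (G.Adj a) ⊆ {x} := fun s hs => by
      rw [Finset.mem_filter] at hs
      exact Finset.mem_singleton.2 ((hax s hs.1).1 hs.2)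
    have := Finset.card_le_card this
    rw [Finset.card_singleton] at this
    omega

omit [Fintype V] in
/-- Lists of size at least two on the diamond (`K₄` minus the edge between `C` and `D`) satisfying
Hall's condition on both triangles admit a proper colouring. Each of `C`, `D` is blocked by at
most one pair `{α, β}`, so it suffices that three such pairs are available; only `A = B` of size
two leaves fewer, and then Hall's condition applies. -/
theorem exists_diamond_list_coloring {A B C D : Finset V} (hA : 2 ≤ A.card) (hB : 2 ≤ B.card)
    (hC : 2 ≤ C.card) (hD : 2 ≤ D.card) (hABC : 3 ≤ (A ∪ (B ∪ C)).card)
    (hABD : 3 ≤ (A ∪ (B ∪ D)).card) :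
    ∃ α ∈ A, ∃ β ∈ B, α ≠ β ∧ (∃ γ ∈ C, γ ≠ α ∧ γ ≠ β) ∧ ∃ δ ∈ D, δ ≠ α ∧ δ ≠ β := by
  obtain ⟨c₁, hc₁, c₂, hc₂, hc⟩ := Finset.one_lt_card.1 hC
  obtain ⟨d₁, hd₁, d₂, hd₂, hd⟩ := Finset.one_lt_card.1 hD
  by_contra hcon
  have hblock : ∀ α ∈ A, ∀ β ∈ B, α ≠ β → s(α, β) = s(c₁, c₂) ∨ s(α, β) = s(d₁, d₂) := by
    intro α hα β hβ hne
    by_contra! hno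
    simp only [ne_eq, Sym2.eq_iff] at hno
    refine hcon ⟨α, hα, β, hβ, hne, ?_, ?_⟩
    · by_cases h1 : c₁ ≠ α ∧ c₁ ≠ β
      · exact ⟨c₁, hc₁, h1⟩
      · exact ⟨c₂, hc₂, by grind⟩
    · by_cases h1 : d₁ ≠ α ∧ d₁ ≠ β
      · exact ⟨d₁, hd₁, h1⟩
      · exact ⟨d₂, hd₂, by grind⟩
  have hpigeon : ∀ e₁ e₂ e₃ : Sym2 V, (e₁ = s(c₁, c₂) ∨ e₁ = s(d₁, d₂)) →
      (e₂ = s(c₁, c₂) ∨ e₂ = s(d₁, d₂)) → (e₃ = s(c₁, c₂) ∨ e₃ = s(d₁, d₂)) →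
      e₁ ≠ e₂ → e₁ ≠ e₃ → e₂ ≠ e₃ → False := by
    rintro _ _ _ (rfl | rfl) (rfl | rfl) (rfl | rfl) h₁ h₂ h₃ <;> contradiction
  by_cases hAB : A ⊆ B
  · by_cases hBA : B ⊆ A
    · obtain rfl := hAB.antisymm hBA
      rcases hA.eq_or_lt with h2 | h3
      · obtain ⟨p, q, hpq, rfl⟩ := Finset.card_eq_two.1 h2.symm
        have key : ∀ E : Finset V, 3 ≤ (({p, q} : Finset V) ∪ ({p, q} ∪ E)).card →
            ∃ γ ∈ E, γ ≠ p ∧ γ ≠ q := by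
          intro E hE
          by_contra! hno
          have : ({p, q} : Finset V) ∪ ({p, q} ∪ E) ⊆ {p, q} := by
            refine Finset.union_subset subset_rfl (Finset.union_subset subset_rfl fun e he => ?_)
            by_cases hep : e = p
            · simp [hep]
            · simp [hno e he hep]
          have := (Finset.card_le_card this).trans Finset.card_le_two
          omega
        exact hcon ⟨p, by simp, q, by simp, hpq, key C hABC, key D hABD⟩
      · obtain ⟨p, hp, q, hq, r, hr, hpq, hpr, hqr⟩ := Finset.two_lt_card.1 h3
        have h1 := hblock p hp q hq hpq
        have h2 := hblock p hp r hr hpr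
        have h3 := hblock q hq r hr hqr
        have n12 : s(p, q) ≠ s(p, r) := mt Sym2.congr_right.1 hqr
        have n13 : s(p, q) ≠ s(q, r) := by
          rw [Sym2.eq_swap]
          exact mt Sym2.congr_right.1 hpr
        have n23 : s(p, r) ≠ s(q, r) := mt Sym2.congr_left.1 hpq
        exact hpigeon _ _ _ h1 h2 h3 n12 n13 n23
    · obtain ⟨x, hxB, hxA⟩ := Finset.not_subset.1 hBA
      obtain ⟨p, hp, q, hq, hpq⟩ := Finset.one_lt_card.1 hA
      obtain ⟨y, hy, hyx⟩ := Finset.exists_mem_ne hB x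
      obtain ⟨z, hz, hzy⟩ := Finset.exists_mem_ne hA y
      have hne : ∀ w ∈ A, w ≠ x := fun w hw h => hxA (h ▸ hw)
      have h1 := hblock p hp x hxB (hne p hp)
      have h2 := hblock q hq x hxB (hne q hq)
      have h3 := hblock z hz y hy hzy
      have n12 : s(p, x) ≠ s(q, x) := mt Sym2.congr_left.1 hpq
      have n3 : ∀ w, s(w, x) ≠ s(z, y) := by
        intro w
        have := hne z hz
        simp only [ne_eq, Sym2.eq_iff]
        grind
      exact hpigeon _ _ _ h1 h2 h3 n12 (n3 p) (n3 q)
  · obtain ⟨x, hxA, hxB⟩ := Finset.not_subset.1 hAB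
    obtain ⟨p, hp, q, hq, hpq⟩ := Finset.one_lt_card.1 hB
    obtain ⟨y, hy, hyx⟩ := Finset.exists_mem_ne hA x
    obtain ⟨z, hz, hzy⟩ := Finset.exists_mem_ne hB y
    have hne : ∀ w ∈ B, w ≠ x := fun w hw h => hxB (h ▸ hw)
    have h1 := hblock x hxA p hp (hne p hp).symm
    have h2 := hblock x hxA q hq (hne q hq).symm
    have h3 := hblock y hy z hz hzy.symm
    have n12 : s(x, p) ≠ s(x, q) := mt Sym2.congr_right.1 hpq
    have n3 : ∀ w, s(x, w) ≠ s(y, z) := by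
      intro w
      have := hne z hz
      simp only [ne_eq, Sym2.eq_iff]
      grind
    exact hpigeon _ _ _ h1 h2 h3 n12 (n3 p) (n3 q)

/-- Four vertices outside a maximum stable set `S`, each with at least two neighbours in `S`. By
greedy extension only the case where they span at most a perfect matching remains; the case of
no edge is Hall's theorem. -/
theorem isCliqueAssignable_of_card_eq_four_of_two_le (hS : G.IsNIndepSet G.indepNum S)
    (hTS : Disjoint T S) (hT : T.card = 4) (hL : ∀ v ∈ T, 2 ≤ (S.filter (G.Adj v)).card) :
    IsCliqueAssignable G S T := by
  by_contra h
  have hgreedy : ∀ v ∈ T, 2 ≤ (T.filter fun u => u ≠ v ∧ ¬ G.Adj u v).card := by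
    intro v hv
    by_contra! hlt
    refine h (IsCliqueAssignable.of_erase (isCliqueAssignable_of_card_eq_three_of_two_le hS
      (hTS.mono_left (Finset.erase_subset _ _)) (by rw [Finset.card_erase_of_mem hv, hT])
      fun u hu => hL u (Finset.mem_of_mem_erase hu)) (hlt.trans_le (hL v hv)))
  obtain ⟨c, hc, d, hd, hcd⟩ := exists_adj_of_not_isCliqueAssignable hS hTS h
  obtain ⟨a, b, hab, hTcd⟩ := Finset.card_eq_two.1 (show ((T.erase c).erase d).card = 2 by
    rw [Finset.card_erase_of_mem (Finset.mem_erase.2 ⟨hcd.ne', hd⟩), Finset.card_erase_of_mem hc,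
      hT])
  have hmem : ∀ u, u ∈ T ↔ u = a ∨ u = b ∨ u = c ∨ u = d := by
    intro u
    have : u ∈ (T.erase c).erase d ↔ u ∈ ({a, b} : Finset V) := by rw [hTcd]
    simp only [Finset.mem_erase, Finset.mem_insert, Finset.mem_singleton] at this
    by_cases huc : u = c
    · simp [huc, hc]
    · by_cases hud : u = d
      · simp [hud, hd]
      · simpa [huc, hud] using this
  have ha' : a ≠ d ∧ a ≠ c ∧ a ∈ T := by
    have : a ∈ (T.erase c).erase d := by simp [hTcd]
    simpa [Finset.mem_erase] using this
  have hb' : b ≠ d ∧ b ≠ c ∧ b ∈ T := by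
    have : b ∈ (T.erase c).erase d := by simp [hTcd]
    simpa [Finset.mem_erase] using this
  obtain ⟨had, hac, ha⟩ := ha'
  obtain ⟨hbd, hbc, hb⟩ := hb'
  -- `c` and `d` have no neighbours in `T` besides each other
  have hnadj : ∀ v w x y, (∀ u, u ∈ T ↔ u = x ∨ u = y ∨ u = v ∨ u = w) → G.Adj v w →
      ¬ G.Adj x v := by
    intro v w x y hm hvw hxv
    have h2 := hgreedy v ((hm v).2 (by simp))
    have : (T.filter fun u => u ≠ v ∧ ¬ G.Adj u v) ⊆ {y} := by
      intro u hu
      rw [Finset.mem_filter, hm] at hu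
      rcases hu with ⟨rfl | rfl | rfl | rfl, hu1, hu2⟩
      · exact absurd hxv hu2
      · simp
      · exact absurd rfl hu1
      · exact absurd hvw.symm hu2
    have := Finset.card_le_card this
    rw [Finset.card_singleton] at this
    omega
  have nac : ¬ G.Adj a c := hnadj c d a b hmem hcd
  have nbc : ¬ G.Adj b c := hnadj c d b a (fun u => (hmem u).trans (by tauto)) hcd
  have nad : ¬ G.Adj a d := hnadj d c a b (fun u => (hmem u).trans (by tauto)) hcd.symm
  have nbd : ¬ G.Adj b d := hnadj d c b a (fun u => (hmem u).trans (by tauto)) hcd.symm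
  have haS := Finset.disjoint_left.1 hTS ha
  have hbS := Finset.disjoint_left.1 hTS hb
  have hcS := Finset.disjoint_left.1 hTS hc
  have hdS := Finset.disjoint_left.1 hTS hd
  obtain ⟨α, hα, β, hβ, hαβ, ⟨γ, hγ, hγα, hγβ⟩, δ, hδ, hδα, hδβ⟩ :
      ∃ α ∈ S.filter (G.Adj a), ∃ β ∈ S.filter (G.Adj b), (α = β → G.Adj a b) ∧
        (∃ γ ∈ S.filter (G.Adj c), γ ≠ α ∧ γ ≠ β) ∧
        ∃ δ ∈ S.filter (G.Adj d), δ ≠ α ∧ δ ≠ β := by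
    -- adjacent `a` and `b` may share a common neighbour in `S`, which leaves room for `c` and `d`
    by_cases hcommon : G.Adj a b ∧ ∃ s, s ∈ S.filter (G.Adj a) ∧ s ∈ S.filter (G.Adj b)
    · obtain ⟨hadj, s, hsa, hsb⟩ := hcommon
      obtain ⟨γ, hγ, hγs⟩ := Finset.exists_mem_ne (hL c hc) s
      obtain ⟨δ, hδ, hδs⟩ := Finset.exists_mem_ne (hL d hd) s
      exact ⟨s, hsa, s, hsb, fun _ => hadj, ⟨γ, hγ, hγs, hγs⟩, δ, hδ, hδs, hδs⟩
    · -- if `a` and `b` are adjacent, their lists are disjoint, so together they have four elements;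
      -- otherwise `{a, b, w}` is stable
      have h3 : ∀ w, w ∉ S → a ≠ w → b ≠ w → ¬ G.Adj a w → ¬ G.Adj b w →
          3 ≤ (S.filter (G.Adj a) ∪ (S.filter (G.Adj b) ∪ S.filter (G.Adj w))).card := by
        intro w hwS haw hbw naw nbw
        by_cases hadj : G.Adj a b
        · have hdisj : Disjoint (S.filter (G.Adj a)) (S.filter (G.Adj b)) :=
            Finset.disjoint_left.2 fun s hsa hsb => hcommon ⟨hadj, s, hsa, hsb⟩
          have h4 := Finset.card_union_of_disjoint hdisj
          have h5 : S.filter (G.Adj a) ∪ S.filter (G.Adj b) ⊆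
              S.filter (G.Adj a) ∪ (S.filter (G.Adj b) ∪ S.filter (G.Adj w)) :=
            Finset.union_subset_union_right Finset.subset_union_left
          have := Finset.card_le_card h5
          have := hL a ha
          have := hL b hb
          omega
        · exact three_le_card_union_filter_adj hS haS hbS hwS hab haw hbw hadj naw nbw
      obtain ⟨α, hα, β, hβ, hne, hγ, hδ⟩ := exists_diamond_list_coloring (hL a ha) (hL b hb)
        (hL c hc) (hL d hd) (h3 c hcS hac hbc nac nbc) (h3 d hdS had hbd nad nbd)
      exact ⟨α, hα, β, hβ, fun h => absurd h hne, hγ, hδ⟩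
  rw [Finset.mem_filter] at hα hβ hγ hδ
  refine h ⟨fun v => if v = a then α else if v = b then β else if v = c then γ else δ,
    fun v hv => ?_, fun u hu v hv hne heq => ?_⟩
  · rcases (hmem v).1 hv with rfl | rfl | rfl | rfl
    · simpa using hα
    · simpa [hab.symm] using hβ
    · simpa [hac.symm, hbc.symm] using hγ
    · simpa [had.symm, hbd.symm, hcd.ne'] using hδ
  · have hcd' := hcd.ne
    have hdc := hcd.symm
    have hba := fun h => (hαβ h).symm
    rcases (hmem u).1 hu with rfl | rfl | rfl | rfl <;>
      rcases (hmem v).1 hv with rfl | rfl | rfl | rfl <;> grind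

end

theorem mainTheorem8 {V : Type*} [Fintype V] [DecidableEq V] (G : SimpleGraph V)
    [DecidableRel G.Adj] :
    (Fintype.card V ≤ G.indepNum + 2 →
      ThetaRank.cliqueCoverNumber G = (G.indepNum : ℕ∞) ∧ ThetaRank.thetaRank G = 0) ∧
    (Fintype.card V = G.indepNum + 3 →
      (¬ ThetaRank.IsC5PlusIsolated G →
        ThetaRank.cliqueCoverNumber G = (G.indepNum : ℕ∞) ∧ ThetaRank.thetaRank G = 0) ∧
      (ThetaRank.IsC5PlusIsolated G →
        1 ≤ ThetaRank.thetaRank G ∧ ThetaRank.IsCritical G)) ∧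
    (Fintype.card V = G.indepNum + 4 → ThetaRank.IsAcritical G →
      ThetaRank.cliqueCoverNumber G = (G.indepNum : ℕ∞) ∧ ThetaRank.thetaRank G = 0) := by
  obtain ⟨S, hS⟩ := G.exists_isNIndepSet_indepNum
  have hcard : Sᶜ.card = Fintype.card V - G.indepNum := by
    rw [Finset.card_compl, hS.card_eq]
  have hgood : IsCliqueAssignable G S Sᶜ →
      ThetaRank.cliqueCoverNumber G = (G.indepNum : ℕ∞) ∧ ThetaRank.thetaRank G = 0 := fun h =>
    cliqueCoverNumber_eq_and_thetaRank_eq_zero G (hS.card_eq ▸ h.compl_colorable)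
  refine ⟨fun hV => hgood ?_, fun hV => ⟨fun h => hgood ?_, fun h => ⟨?_, ?_⟩⟩,
    fun hV h => hgood ?_⟩
  · exact isCliqueAssignable_of_card_le_two hS disjoint_compl_left (by omega)
  · exact isCliqueAssignable_compl_of_card_eq_three hS (by omega) h
  · exact one_le_thetaRank_of_isC5PlusIsolated G h hV
  · exact isCritical_of_isC5PlusIsolated h hV
  · exact isCliqueAssignable_of_card_eq_four_of_two_le hS disjoint_compl_left (by omega)
      fun v hv => two_le_card_filter_adj_of_isAcritical h hS (Finset.mem_compl.1 hv)
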